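/- Let $f:\mathbb R^d\to\mathbb R\cup\{\infty\}$, let $\mathcal X=\{x: f(x)<\infty\}$ be open and convex, and let $f$ be continuous (as a map into $\mathbb R\cup\{\infty\}$) on the closure of $\mathcal X$ and twice differentiable on $\mathcal X$. Suppose that $\|\nabla^2 f(x)\|\le \ell(\|\nabla f(x)\|)$ for all $x\in\mathcal X$, where $\ell:[0,\infty)\to(0,\infty)$ is non-decreasing and locally Lipschitz with $r:=\sup_{s\ge 0}\ell(2s)/\ell(s)<\infty$. Let $f^*\in\mathbb R$ satisfy $f(x)\ge f^*$ for all $x\in\mathcal X$, let $x_0\in\mathcal X$, and put $\Delta=f(x_0)-f^*$. Suppose that, for some $\sigma>0$ and all $x\in\mathcal X$, the stochastic gradients satisfy $\mathbb E_\xi[\nabla f(x;\xi)]=\nabla f(x)$ and $\mathbb E_\xi\big[\exp(\|\nabla f(x;\xi)-\nabla f(x)\|^2/\sigma^2)\big]\le e$. For a batch size $B$, minibatch SGD started at $x_0$ is, for $k=0,1,\dots$ and i.i.d. samples $\xi_{kj}$, $$g_k=\frac1B\sum_{j=1}^{B}\nabla f(x_k;\xi_{kj}),\qquad \gamma_k=\frac1{5r}\int_0^1\frac{dv}{\ell(\|g_k\|+\|g_k\|v)},\qquad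 x_{k+1}=x_k-\gamma_k g_k .$$ Let $\varepsilon>0$, $\delta\in(0,1)$, let $T\ge 1$ be an integer, and let $$B=\max\left\{\left\lceil 32\left(1+\sqrt{3\log(T/\delta)}\right)^2\sigma^2/\varepsilon\right\rceil,1\right\}.$$ Suppose that $T$ is large enough that the bound $$\min_{0\le k\le T-1}\frac{\left(\frac32\|\nabla f(x_k)\|\right)^2}{\ell(3\|\nabla f(x_k)\|)}\le r\cdot\frac{45\Delta}{T}$$ ensures $\min_{0\le k\le T-1}\|\nabla f(x_k)\|^2\le\varepsilon$; that is, almost surely, if $x_0,\dots,x_{T-1}\in\mathcal X$ and the bound holds, then $\min_{0\le k\le T-1}\|\nabla f(x_k)\|^2\le\varepsilon$. (It suffices that every $x\in\mathcal X$ with $(\frac32\|\nabla f(x)\|)^2/\ell(3\|\nabla f(x)\|)\le 45r\Delta/T$ satisfies $\|\nabla f(x)\|^2\le\varepsilon$.) Then, with probability at least $1-\delta$, minibatch SGD with batch size $B$ finds an $\varepsilon$-stationary point within $T$ iterations: there is $k\in\{0,\dots,T-1\}$ with $x_0,\dots,x_k\in\mathcal X$ and $\|\nabla f(x_k)\|^2\le\varepsilon$.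 The total number of stochastic gradients computed in the $T$ iterations is $B\cdot T$. -/

import Mathlib

open MeasureTheory ProbabilityTheory

noncomputable section

namespace EllSmooth

/-- The space `ℝ^d` with its Euclidean norm. -/
abbrev Space (d : ℕ) : Type := EuclideanSpace ℝ (Fin d)

/-- The effective domain `X = {x | f x < ∞}` of an extended-real-valued function. -/
def domain {d : ℕ} (f : Space d → EReal) : Set (Space d) := {x | f x < ⊤}

/-- The real-valued representative of `f`, meaningful on its effective domain. -/
def realPart {d : ℕ} (f : Space d → EReal) (x : Space d) : ℝ := (f x).toReal

/-- The gradient of `f`, meaningful at the points of the (open) effective domain where `f` is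
differentiable. -/
def grad {d : ℕ} (f : Space d → EReal) (x : Space d) : Space d := gradient (realPart f) x

/-- The Hessian of `f`, as the derivative of the gradient. Its norm is the spectral norm. -/
def hess {d : ℕ} (f : Space d → EReal) (x : Space d) : Space d →L[ℝ] Space d :=
  fderiv ℝ (grad f) x

/-- `f : ℝ^d → ℝ ∪ {∞}` is `ℓ`-smooth for a given `ℓ : [0, ∞) → (0, ∞)`; only the values of `ℓ` on
`[0, ∞)` matter. Continuity on the closure of the domain is continuity as a map into
`ℝ ∪ {∞}`, so `f` tends to `∞` at boundary points of its (open) domain. -/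
structure IsEllSmooth {d : ℕ} (ℓ : ℝ → ℝ) (f : Space d → EReal) : Prop where
  ne_bot : ∀ x, f x ≠ ⊥
  isOpen_domain : IsOpen (domain f)
  convex_domain : Convex ℝ (domain f)
  continuousOn_closure : ContinuousOn f (closure (domain f))
  differentiable : ∀ x ∈ domain f, DifferentiableAt ℝ (realPart f) x
  twice_differentiable : ∀ x ∈ domain f, DifferentiableAt ℝ (grad f) x
  ell_monotone : MonotoneOn ℓ (Set.Ici 0)
  ell_pos : ∀ s, 0 ≤ s → 0 < ℓ s
  ell_locallyLipschitz : LocallyLipschitzOn (Set.Ici 0) ℓ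
  hess_le : ∀ x ∈ domain f, ‖hess f x‖ ≤ ℓ ‖grad f x‖

/-- The stochastic gradients `G x ξ`, with `ξ` distributed according to `P`, are unbiased and have
light tails with parameter `σ`. (The exponential moment condition forces integrability, so the
expectation in `unbiased` is a genuine one.) -/
structure IsLightTailedOracle {d : ℕ} {Ξ : Type*} [MeasurableSpace Ξ] (f : Space d → EReal)
    (G : Space d → Ξ → Space d) (P : Measure Ξ) (σ : ℝ) : Prop where
  measurable : Measurable (Function.uncurry G)
  unbiased : ∀ x ∈ domain f, ∫ z, G x z ∂P = grad f x
  light_tail : ∀ x ∈ domain f,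
    ∫⁻ z, ENNReal.ofReal (Real.exp (‖G x z - grad f x‖ ^ 2 / σ ^ 2)) ∂P
      ≤ ENNReal.ofReal (Real.exp 1)

/-- The set of ratios `ℓ (2 s) / ℓ s`, `s ≥ 0`. -/
def ratioSet (ℓ : ℝ → ℝ) : Set ℝ := (fun s => ℓ (2 * s) / ℓ s) '' Set.Ici 0

/-- The ratio `r = sup_{s ≥ 0} ℓ (2 s) / ℓ s`, meaningful when `ratioSet ℓ` is bounded above. -/
def ratio (ℓ : ℝ → ℝ) : ℝ := sSup (ratioSet ℓ)

/-- The step size `γ = (1 / (5 r)) ∫₀¹ dv / ℓ (‖g‖ + ‖g‖ v)`. -/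
def stepSize {d : ℕ} (ℓ : ℝ → ℝ) (g : Space d) : ℝ :=
  1 / (5 * ratio ℓ) * ∫ v in (0 : ℝ)..1, 1 / ℓ (‖g‖ + ‖g‖ * v)

/-- State of the method: the current point and the number of stochastic gradients computed. -/
structure State (d : ℕ) where
  point : Space d
  calls : ℕ

/-- Query the oracle at `x` on the samples `s 0, …, s (B - 1)`, one at a time: the sum of the
answers and the number of queries made. -/
def queryBatch {d : ℕ} {Ξ : Type*} (G : Space d → Ξ → Space d) (x : Space d) (s : ℕ → Ξ) :
    ℕ → Space d × ℕ
  | 0 => (0, 0)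
  | j + 1 => ((queryBatch G x s j).1 + G x (s j), (queryBatch G x s j).2 + 1)

/-- Minibatch gradient estimator `g = (1 / B) ∑_{j < B} G x (s j)`. -/
def batchGrad {d : ℕ} {Ξ : Type*} (G : Space d → Ξ → Space d) (B : ℕ) (x : Space d)
    (s : ℕ → Ξ) : Space d :=
  (1 / (B : ℝ)) • (queryBatch G x s B).1

/-- Stochastic gradient descent with batch size `B` started at `x₀`: the state after `k`
iterations, where iteration `k` uses the samples `s k 0, …, s k (B - 1)`. -/
def sgd {d : ℕ} {Ξ : Type*} (ℓ : ℝ → ℝ) (G : Space d → Ξ → Space d) (B : ℕ) (x₀ : Space d)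
    (s : ℕ → ℕ → Ξ) : ℕ → State d
  | 0 => ⟨x₀, 0⟩
  | k + 1 =>
    let st := sgd ℓ G B x₀ s k
    let g := batchGrad G B st.point (s k)
    ⟨st.point - stepSize ℓ g • g, st.calls + (queryBatch G st.point (s k) B).2⟩

/-- The batch size `B = max {⌈32 (1 + √(3 log (T / δ)))² σ² / ε⌉, 1}`. -/
def batchSize (T : ℕ) (δ σ ε : ℝ) : ℕ :=
  max ⌈32 * (1 + Real.sqrt (3 * Real.log (T / δ))) ^ 2 * σ ^ 2 / ε⌉₊ 1

/-- `min_{k ∈ {0, …, T - 1}} a k` for `T ≥ 1`. -/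
def minIter (T : ℕ) (hT : 1 ≤ T) (a : ℕ → ℝ) : ℝ :=
  (Finset.range T).inf' ⟨0, Finset.mem_range.mpr hT⟩ a

end EllSmooth

end

/-!
Write `n = ‖∇f(x)‖` and call an estimator `g` of `∇f(x)` accurate if `‖g - ∇f(x)‖ ≤ n / 4`. Since
`ℓ (2 s) ≤ r ℓ s`, the step size at an accurate `g` satisfies
`1 / (5 r ℓ(3 n)) ≤ γ ≤ 1 / (5 ℓ(3 n / 2))`. The upper bound makes the step so short that the
gradient moves by at most `n / 3` along it: its norm cannot reach `3 n / 2`, and below that value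
the Hessian is bounded by `ℓ(3 n / 2)` (`IsEllSmooth.norm_grad_sub_le`). Hence `f` decreases along
the step, which therefore cannot reach the boundary of the domain, where `f = ∞`
(`IsEllSmooth.sub_smul_mem_domain`), and by the lower bound on `γ` the decrease is at least
`(3 n / 2)² / (45 r ℓ(3 n))` (`IsEllSmooth.step`). Over `T` steps these decreases sum to at most
`Δ`, which is the bound on the minimum over the iterates that forces an `ε`-stationary point.

As long as no `ε`-stationary point has been met, `n > √ε`, so it is enough that every estimator is
within `√ε / 4` of the gradient. The iterate `x_k` depends on earlier samples only and is thus
independent of the `k`-th batch (`measure_sgd_point_batch_le`), so the probability of failure can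
be estimated at a fixed point; there it is at most `δ / T`
(`IsLightTailedOracle.measure_batch_sub_grad_gt_le`), and a union bound over `k < T` concludes.

The estimate at a fixed point is the dimension-free deviation inequality
`P (‖ζ₁ + ⋯ + ζₙ‖ ≥ √2 (1 + λ) σ √n) ≤ exp (-λ² / 3)` (`measure_norm_sum_ge_le`). It follows from
Markov's inequality for a function `V` whose mean grows by at most a fixed factor with every
centred summand (`IsPotential`). For `λ ≥ 1 / 5` this is `V = cosh (t ‖·‖)`, as in Pinelis' work:
`cosh ‖a + z‖` is at most `cosh ‖a‖ (exp ‖z‖ - ‖z‖)` plus a term linear in `z`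
(`cosh_norm_add_le`), and `exp q - q ≤ exp (q²)`. For small `λ` the factor `2` in
`exp s ≤ 2 cosh s` is too expensive, and `V = 1 + τ ‖·‖²`, a form of Chebyshev's inequality, is used.
-/

namespace EllSmooth

/-! ### Concentration of sums of light-tailed vectors -/

lemma exp_sub_self_le_exp_sq {q : ℝ} (hq : 0 ≤ q) : Real.exp q - q ≤ Real.exp (q ^ 2) := by
  rcases le_total q 1 with h | h
  · have h1 := (abs_le.mp (Real.abs_exp_sub_one_sub_id_le (abs_le.mpr ⟨by linarith, h⟩))).2
    have h2 := Real.add_one_le_exp (q ^ 2)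
    linarith
  · have h1 : Real.exp q ≤ Real.exp (q ^ 2) := Real.exp_le_exp.mpr (by nlinarith)
    linarith

/-- The function `s ↦ cosh √s` is convex: its power series has non-negative coefficients. -/
lemma cosh_le_of_sq_eq {u v w θ : ℝ} (hθ : 0 ≤ θ) (hθ1 : θ ≤ 1)
    (h : w ^ 2 = (1 - θ) * u ^ 2 + θ * v ^ 2) :
    Real.cosh w ≤ (1 - θ) * Real.cosh u + θ * Real.cosh v := by
  refine hasSum_le (fun n => ?_) (Real.hasSum_cosh w)
    (((Real.hasSum_cosh u).mul_left (1 - θ)).add ((Real.hasSum_cosh v).mul_left θ))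
  have hc := (convexOn_pow (𝕜 := ℝ) n).2 (Set.mem_Ici.mpr (sq_nonneg u))
    (Set.mem_Ici.mpr (sq_nonneg v)) (sub_nonneg.mpr hθ1) hθ (by ring)
  simp only [smul_eq_mul] at hc
  rw [← h] at hc
  rw [pow_mul, pow_mul, pow_mul, ← mul_div_assoc, ← mul_div_assoc, ← add_div]
  gcongr

section

variable {E : Type*} [NormedAddCommGroup E] [MeasurableSpace E] [BorelSpace E]
  [SecondCountableTopology E] {Ξ : Type*} [MeasurableSpace Ξ] {P : Measure Ξ} {ζ : Ξ → E} {σ : ℝ}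

lemma integrable_exp_sq (hζ : Measurable ζ)
    (htail : ∫⁻ z, ENNReal.ofReal (Real.exp (‖ζ z‖ ^ 2 / σ ^ 2)) ∂P
      ≤ ENNReal.ofReal (Real.exp 1)) :
    Integrable (fun z => Real.exp (‖ζ z‖ ^ 2 / σ ^ 2)) P := by
  refine ⟨by fun_prop, ?_⟩
  rw [hasFiniteIntegral_iff_ofReal (Filter.Eventually.of_forall fun z => (Real.exp_pos _).le)]
  exact htail.trans_lt ENNReal.ofReal_lt_top

lemma integrable_of_exp_sq (hσ : 0 < σ) (hζ : Measurable ζ)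
    (hint : Integrable (fun z => Real.exp (‖ζ z‖ ^ 2 / σ ^ 2)) P) : Integrable ζ P := by
  refine (hint.const_mul σ).mono' (by fun_prop) (Filter.Eventually.of_forall fun z => ?_)
  have h1 := Real.add_one_le_exp (‖ζ z‖ ^ 2 / σ ^ 2)
  rw [← div_le_iff₀' hσ]
  rw [← div_pow] at h1 ⊢
  nlinarith [sq_nonneg (‖ζ z‖ / σ - 1)]

end

section

variable {E : Type*} [NormedAddCommGroup E] [InnerProductSpace ℝ E]

/-- A second-order expansion of `cosh ‖·‖` whose remainder does not see the dimension. For fixed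
norms `‖a‖` and `‖z‖`, the left side is convex in `⟪a, z⟫` and the right side is affine in it, so
that only the case of collinear `a` and `z` matters. -/
lemma cosh_norm_add_le (a z : E) :
    Real.cosh ‖a + z‖ ≤ Real.cosh ‖a‖ * (Real.exp ‖z‖ - ‖z‖)
      + Real.sinh ‖a‖ / ‖a‖ * inner ℝ a z := by
  have hq : 0 ≤ ‖z‖ := norm_nonneg z
  have hsq : ‖z‖ ≤ Real.sinh ‖z‖ := Real.self_le_sinh_iff.mpr hq
  have hexp : Real.exp ‖z‖ = Real.cosh ‖z‖ + Real.sinh ‖z‖ := (Real.cosh_add_sinh _).symm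
  rcases (norm_nonneg a).eq_or_lt with ha | ha
  · have : a = 0 := norm_eq_zero.mp ha.symm
    subst this
    simp
    linarith
  rcases hq.eq_or_lt with hz | hz
  · have : z = 0 := norm_eq_zero.mp hz.symm
    subst this
    simp
  set p := ‖a‖
  set q := ‖z‖
  obtain ⟨c, hc⟩ : ∃ c, inner ℝ a z = p * q * c :=
    ⟨inner ℝ a z / (p * q), by field_simp⟩
  have habs := abs_le.mp (abs_real_inner_le_norm a z)
  have hpq : 0 < p * q := mul_pos ha hz
  have hc1 : c ≤ 1 := by
    by_contra! hlt
    nlinarith [habs.2]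
  have hc2 : -1 ≤ c := by
    by_contra! hlt
    nlinarith [habs.1]
  have key := cosh_le_of_sq_eq (u := p - q) (v := p + q) (w := ‖a + z‖) (θ := (1 + c) / 2)
    (by linarith) (by linarith) (by rw [norm_add_sq_real, hc]; ring)
  rw [Real.cosh_sub, Real.cosh_add] at key
  have hlin : Real.sinh p / p * inner ℝ a z = Real.sinh p * q * c := by
    rw [hc]; field_simp
  rw [hlin, hexp]
  have hs0 : 0 ≤ Real.sinh p := Real.sinh_nonneg_iff.mpr ha.le
  have hs1 : Real.sinh p ≤ Real.cosh p := (Real.sinh_lt_cosh p).le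
  have h3 : Real.sinh p * c ≤ Real.cosh p := by nlinarith
  nlinarith [mul_nonneg (sub_nonneg.mpr h3) (sub_nonneg.mpr hsq)]

/-- `V` is a potential for the sums of `σ`-light-tailed vectors: a centred step `z` increases it in
mean at most by the factor `α + β`, as long as `exp (‖z‖² / σ²)` has mean at most `e`. -/
structure IsPotential (V : E → ℝ) (σ α β : ℝ) : Prop where
  nonneg : ∀ a, 0 ≤ V a
  continuous : Continuous V
  fst_nonneg : 0 ≤ α
  snd_nonneg : 0 ≤ β
  step_le : ∀ a, ∃ c : E, ∀ z, V (a + z) ≤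
    V a * (α * Real.exp (‖z‖ ^ 2 / σ ^ 2 - 1) + β) + inner ℝ c z

lemma isPotential_one_add_sq {σ τ : ℝ} (hσ : 0 < σ) (hτ : 0 ≤ τ) :
    IsPotential (fun a : E => 1 + τ * ‖a‖ ^ 2) σ (τ * σ ^ 2) 1 where
  nonneg a := by positivity
  continuous := by fun_prop
  fst_nonneg := by positivity
  snd_nonneg := zero_le_one
  step_le a := by
    refine ⟨(2 * τ) • a, fun z => ?_⟩
    rw [norm_add_sq_real, inner_smul_left]
    simp only [conj_trivial]
    have h1 : ‖z‖ ^ 2 / σ ^ 2 ≤ Real.exp (‖z‖ ^ 2 / σ ^ 2 - 1) := by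
      have := Real.add_one_le_exp (‖z‖ ^ 2 / σ ^ 2 - 1)
      linarith
    rw [div_le_iff₀ (by positivity)] at h1
    have h2 : 0 ≤ τ * ‖a‖ ^ 2 * (τ * σ ^ 2 * Real.exp (‖z‖ ^ 2 / σ ^ 2 - 1)) := by positivity
    nlinarith [mul_le_mul_of_nonneg_left h1 hτ]

lemma isPotential_cosh {σ t : ℝ} (hσ : 0 < σ) (ht : 0 ≤ t) :
    ∃ α β, α + β = Real.exp (t ^ 2 * σ ^ 2) ∧
      IsPotential (fun a : E => Real.cosh (t * ‖a‖)) σ α β := by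
  -- By convexity of `exp`, `exp (p (X - 1)) ≤ p exp (X - 1) + (1 - p)` for `p ∈ [0, 1]`.
  have hconv : ∀ p X : ℝ, 0 ≤ p → p ≤ 1 →
      Real.exp (p * X) ≤ Real.exp p * (p * Real.exp (X - 1) + (1 - p)) := by
    intro p X hp hp1
    have h := convexOn_exp.2 (Set.mem_univ (X - 1)) (Set.mem_univ 0) hp
      (sub_nonneg.mpr hp1) (by ring)
    simp only [smul_eq_mul, mul_zero, add_zero, Real.exp_zero, mul_one] at h
    calc Real.exp (p * X) = Real.exp p * Real.exp (p * (X - 1)) := by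
          rw [← Real.exp_add]; ring_nf
      _ ≤ _ := by gcongr
  obtain ⟨p, hp, hp1, hstep⟩ : ∃ p : ℝ, 0 ≤ p ∧ p ≤ 1 ∧ ∀ z : E,
      Real.exp (t * ‖z‖) - t * ‖z‖ ≤
        Real.exp (t ^ 2 * σ ^ 2) * (p * Real.exp (‖z‖ ^ 2 / σ ^ 2 - 1) + (1 - p)) := by
    rcases le_total (t ^ 2 * σ ^ 2) 1 with h | h
    · refine ⟨t ^ 2 * σ ^ 2, by positivity, h, fun z => ?_⟩
      refine le_trans ?_ (hconv _ _ (by positivity) h)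
      refine (exp_sub_self_le_exp_sq (by positivity)).trans_eq ?_
      congr 1
      field_simp
    · -- Here `exp q ≤ exp (q²)` is useless, as `t² ‖z‖²` may have no exponential moment;
      -- `t ‖z‖ ≤ t² σ² / 2 + ‖z‖² / (2 σ²)` is used instead.
      refine ⟨1 / 2, by norm_num, by norm_num, fun z => ?_⟩
      have h1 : Real.exp (t * ‖z‖) - t * ‖z‖ ≤
          Real.exp (t ^ 2 * σ ^ 2 - 1 / 2) * Real.exp (1 / 2 * (‖z‖ ^ 2 / σ ^ 2)) := by
        rw [← Real.exp_add]
        have h0 : 0 ≤ t * ‖z‖ := by positivity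
        refine (sub_le_self _ h0).trans (Real.exp_le_exp.mpr ?_)
        have h2 : t * ‖z‖ = (t * σ) * (‖z‖ / σ) := by field_simp
        have h3 : ‖z‖ ^ 2 / σ ^ 2 = (‖z‖ / σ) ^ 2 := by rw [div_pow]
        rw [h2, h3]
        nlinarith [sq_nonneg (t * σ - ‖z‖ / σ)]
      refine h1.trans ?_
      have h4 := hconv (1 / 2) (‖z‖ ^ 2 / σ ^ 2) (by norm_num) (by norm_num)
      refine (mul_le_mul_of_nonneg_left h4 (Real.exp_pos _).le).trans_eq ?_
      rw [← mul_assoc, ← Real.exp_add]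
      congr 2
      ring
  refine ⟨Real.exp (t ^ 2 * σ ^ 2) * p, Real.exp (t ^ 2 * σ ^ 2) * (1 - p), by ring, ?_⟩
  refine ⟨fun a => (Real.cosh_pos _).le, Real.continuous_cosh.comp (by fun_prop), by positivity,
    mul_nonneg (Real.exp_pos _).le (by linarith), fun a => ?_⟩
  refine ⟨(Real.sinh ‖t • a‖ / ‖t • a‖ * t ^ 2) • a, fun z => ?_⟩
  have hnorm : ∀ w : E, ‖t • w‖ = t * ‖w‖ := fun w => by
    rw [norm_smul, Real.norm_of_nonneg ht]
  have h := cosh_norm_add_le (t • a) (t • z)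
  rw [← smul_add, inner_smul_left, inner_smul_right] at h
  rw [inner_smul_left]
  simp only [conj_trivial, hnorm] at h ⊢
  have h2 := mul_le_mul_of_nonneg_left (hstep z) (Real.cosh_pos (t * ‖a‖)).le
  linarith

variable [CompleteSpace E] [MeasurableSpace E] [BorelSpace E] [SecondCountableTopology E]
  {Ξ : Type*} [MeasurableSpace Ξ] {P : Measure Ξ} [IsProbabilityMeasure P] {ζ : Ξ → E}
  {σ α β : ℝ} {V : E → ℝ}

lemma IsPotential.lintegral_step_le (hV : IsPotential V σ α β) (hσ : 0 < σ)
    (hζ : Measurable ζ) (hmean : ∫ z, ζ z ∂P = 0)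
    (htail : ∫⁻ z, ENNReal.ofReal (Real.exp (‖ζ z‖ ^ 2 / σ ^ 2)) ∂P
      ≤ ENNReal.ofReal (Real.exp 1)) (a : E) :
    ∫⁻ z, ENNReal.ofReal (V (a + ζ z)) ∂P ≤ ENNReal.ofReal ((α + β) * V a) := by
  obtain ⟨c, hc⟩ := hV.step_le a
  have hint := integrable_exp_sq hζ htail
  have hζi := integrable_of_exp_sq hσ hζ hint
  have hexp : ∫ z, Real.exp (‖ζ z‖ ^ 2 / σ ^ 2) ∂P ≤ Real.exp 1 := by
    rw [integral_eq_lintegral_of_nonneg_ae (Filter.Eventually.of_forall fun z =>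
      (Real.exp_pos _).le) hint.1]
    exact ENNReal.toReal_le_of_le_ofReal (Real.exp_pos _).le htail
  have hi1 : Integrable (fun z => V a * (α * Real.exp (‖ζ z‖ ^ 2 / σ ^ 2 - 1) + β)) P := by
    simp only [Real.exp_sub]
    exact (((hint.div_const _).const_mul α).add (integrable_const β)).const_mul _
  have hi2 : Integrable (fun z => inner ℝ c (ζ z)) P := hζi.const_inner c
  calc ∫⁻ z, ENNReal.ofReal (V (a + ζ z)) ∂P
      ≤ ∫⁻ z, ENNReal.ofReal (V a * (α * Real.exp (‖ζ z‖ ^ 2 / σ ^ 2 - 1) + β)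
          + inner ℝ c (ζ z)) ∂P :=
        lintegral_mono fun z => ENNReal.ofReal_le_ofReal (hc _)
    _ = ENNReal.ofReal (∫ z, V a * (α * Real.exp (‖ζ z‖ ^ 2 / σ ^ 2 - 1) + β)
          + inner ℝ c (ζ z) ∂P) :=
        (ofReal_integral_eq_lintegral_ofReal (hi1.add hi2)
          (Filter.Eventually.of_forall fun z => (hV.nonneg _).trans (hc _))).symm
    _ ≤ ENNReal.ofReal ((α + β) * V a) := by
        refine ENNReal.ofReal_le_ofReal ?_
        rw [integral_add hi1 hi2, integral_inner hζi, hmean, inner_zero_right, add_zero,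
          integral_const_mul]
        simp only [Real.exp_sub]
        rw [integral_add ((hint.div_const _).const_mul α) (integrable_const β),
          integral_const_mul, integral_div, integral_const, probReal_univ, one_smul, mul_comm]
        have h1 : (∫ z, Real.exp (‖ζ z‖ ^ 2 / σ ^ 2) ∂P) / Real.exp 1 ≤ 1 :=
          (div_le_one (Real.exp_pos _)).mpr hexp
        have h2 := mul_le_mul_of_nonneg_left h1 hV.fst_nonneg
        exact mul_le_mul_of_nonneg_right (by linarith) (hV.nonneg a)

lemma IsPotential.lintegral_sum_le (hV : IsPotential V σ α β) (hσ : 0 < σ)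
    (hζ : Measurable ζ) (hmean : ∫ z, ζ z ∂P = 0)
    (htail : ∫⁻ z, ENNReal.ofReal (Real.exp (‖ζ z‖ ^ 2 / σ ^ 2)) ∂P
      ≤ ENNReal.ofReal (Real.exp 1)) (n : ℕ) (a : E) :
    ∫⁻ s, ENNReal.ofReal (V (a + ∑ j : Fin n, ζ (s j))) ∂(Measure.pi fun _ : Fin n => P)
      ≤ ENNReal.ofReal ((α + β) ^ n * V a) := by
  have hVm : Measurable V := hV.continuous.measurable
  have hαβ : 0 ≤ α + β := add_nonneg hV.fst_nonneg hV.snd_nonneg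
  induction n generalizing a with
  | zero => simp
  | succ n ih =>
    have hmp := measurePreserving_piFinSuccAbove (fun _ : Fin (n + 1) => P) 0
    let F : Ξ × (Fin n → Ξ) → ENNReal := fun y =>
      ENNReal.ofReal (V (a + ζ y.1 + ∑ j, ζ (y.2 j)))
    have hF : Measurable F := by
      refine ENNReal.measurable_ofReal.comp (hVm.comp ?_)
      refine ((hζ.comp measurable_fst).const_add a).add (Finset.measurable_sum _ fun j _ => ?_)
      exact hζ.comp ((measurable_pi_apply j).comp measurable_snd)
    calc ∫⁻ s, ENNReal.ofReal (V (a + ∑ j : Fin (n + 1), ζ (s j)))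
            ∂(Measure.pi fun _ : Fin (n + 1) => P)
        = ∫⁻ s, F (MeasurableEquiv.piFinSuccAbove (fun _ => Ξ) 0 s)
            ∂(Measure.pi fun _ : Fin (n + 1) => P) := by
          refine lintegral_congr fun s => ?_
          simp only [F, Fin.sum_univ_succ, add_assoc]
          rfl
      _ = ∫⁻ y, F y ∂(P.prod (Measure.pi fun _ : Fin n => P)) := hmp.lintegral_comp hF
      _ = ∫⁻ z, ∫⁻ s, F (z, s) ∂(Measure.pi fun _ : Fin n => P) ∂P :=
          lintegral_prod _ hF.aemeasurable
      _ ≤ ∫⁻ z, ENNReal.ofReal ((α + β) ^ n) * ENNReal.ofReal (V (a + ζ z)) ∂P := by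
          refine lintegral_mono fun z => (ih (a + ζ z)).trans_eq ?_
          rw [ENNReal.ofReal_mul (by positivity)]
      _ = ENNReal.ofReal ((α + β) ^ n) * ∫⁻ z, ENNReal.ofReal (V (a + ζ z)) ∂P :=
          lintegral_const_mul _ (ENNReal.measurable_ofReal.comp (hVm.comp (hζ.const_add a)))
      _ ≤ ENNReal.ofReal ((α + β) ^ n) * ENNReal.ofReal ((α + β) * V a) := by
          gcongr
          exact hV.lintegral_step_le hσ hζ hmean htail a
      _ = ENNReal.ofReal ((α + β) ^ (n + 1) * V a) := by
          rw [← ENNReal.ofReal_mul (by positivity)]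
          ring_nf

/-- Markov's inequality for a potential. -/
lemma IsPotential.measure_le (hV : IsPotential V σ α β) (hσ : 0 < σ)
    (hζ : Measurable ζ) (hmean : ∫ z, ζ z ∂P = 0)
    (htail : ∫⁻ z, ENNReal.ofReal (Real.exp (‖ζ z‖ ^ 2 / σ ^ 2)) ∂P
      ≤ ENNReal.ofReal (Real.exp 1)) (n : ℕ) {R v : ℝ} (hv : 0 < v)
    (hR : ∀ w : E, R ≤ ‖w‖ → v ≤ V w) :
    Measure.pi (fun _ : Fin n => P) {s | R ≤ ‖∑ j, ζ (s j)‖}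
      ≤ ENNReal.ofReal ((α + β) ^ n * V 0 / v) := by
  have hint := hV.lintegral_sum_le hσ hζ hmean htail n 0
  simp only [zero_add] at hint
  rw [ENNReal.ofReal_div_of_pos hv]
  have hm : Measurable fun s : Fin n → Ξ => ENNReal.ofReal (V (∑ j, ζ (s j))) :=
    ENNReal.measurable_ofReal.comp (hV.continuous.measurable.comp
      (Finset.measurable_sum _ fun j _ => hζ.comp (measurable_pi_apply j)))
  refine le_trans (measure_mono fun s hs => ?_)
    ((meas_ge_le_lintegral_div hm.aemeasurable (ENNReal.ofReal_pos.mpr hv).ne'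
      ENNReal.ofReal_ne_top).trans (ENNReal.div_le_div_right hint _))
  exact ENNReal.ofReal_le_ofReal (hR _ hs)

/-- The deviation inequality of Juditsky and Nemirovski for sums of independent centred
light-tailed vectors in a Hilbert space. Its constants do not depend on the dimension. -/
theorem measure_norm_sum_ge_le (hσ : 0 < σ) (hζ : Measurable ζ) (hmean : ∫ z, ζ z ∂P = 0)
    (htail : ∫⁻ z, ENNReal.ofReal (Real.exp (‖ζ z‖ ^ 2 / σ ^ 2)) ∂P
      ≤ ENNReal.ofReal (Real.exp 1)) {n : ℕ} (hn : 0 < n) {lam R : ℝ} (hlam : 0 ≤ lam)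
    (hR : 0 ≤ R) (hR2 : 2 * (1 + lam) ^ 2 * σ ^ 2 * n ≤ R ^ 2) :
    Measure.pi (fun _ : Fin n => P) {s | R ≤ ‖∑ j, ζ (s j)‖}
      ≤ ENNReal.ofReal (Real.exp (-(lam ^ 2 / 3))) := by
  have hn' : (0 : ℝ) < n := Nat.cast_pos.mpr hn
  rcases le_total lam (1 / 5) with hl | hl
  · -- Small deviations: the quadratic potential, with `τ` chosen so that `n τ σ² = 1 / 2`.
    set τ : ℝ := 1 / (2 * n * σ ^ 2) with hτ
    have hτ0 : 0 < τ := by positivity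
    refine ((isPotential_one_add_sq hσ hτ0.le).measure_le hσ hζ hmean htail n (R := R) two_pos
      fun w hw => ?_).trans (ENNReal.ofReal_le_ofReal ?_)
    · have h1 : R ^ 2 ≤ ‖w‖ ^ 2 := by gcongr
      have h2 : 2 * n * σ ^ 2 ≤ ‖w‖ ^ 2 := by
        have : 0 ≤ σ ^ 2 * n * (2 * lam + lam ^ 2) := by positivity
        nlinarith
      have h3 : 1 ≤ τ * ‖w‖ ^ 2 := by
        rw [hτ, one_div, inv_mul_eq_div, one_le_div (by positivity)]
        exact h2
      linarith
    · have h1 : (τ * σ ^ 2 + 1) ^ n ≤ Real.exp (1 / 2) := by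
        calc (τ * σ ^ 2 + 1) ^ n ≤ Real.exp (τ * σ ^ 2) ^ n := by
              gcongr
              exact Real.add_one_le_exp _
          _ = Real.exp (1 / 2) := by
              rw [← Real.exp_nat_mul]
              congr 1
              rw [hτ]
              field_simp
      have h2 : Real.exp (1 / 2) ≤ 7 / 4 := by
        have h3 : Real.exp (1 / 2) ^ 2 = Real.exp 1 := by
          rw [← Real.exp_nat_mul]; norm_num
        nlinarith [Real.exp_one_lt_d9, Real.exp_pos (1 / 2)]
      have h4 := Real.add_one_le_exp (-(lam ^ 2 / 3))
      simp only [norm_zero, ne_eq, OfNat.ofNat_ne_zero, not_false_eq_true, zero_pow, mul_zero,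
        add_zero, mul_one]
      nlinarith
  · -- Large deviations: the potential `cosh (t ‖·‖)`, with the `t` that minimises
    -- `n t² σ² - t R₀` for `R₀² = 2 (1 + lam)² σ² n`.
    set u : ℝ := Real.sqrt 2 * (1 + lam) with hu
    have hu2 : u ^ 2 = 2 * (1 + lam) ^ 2 := by
      rw [hu, mul_pow, Real.sq_sqrt zero_le_two]
    have hu0 : 0 < u := by positivity
    set m : ℝ := Real.sqrt n with hm
    have hm2 : m ^ 2 = n := Real.sq_sqrt hn'.le
    have hm0 : 0 < m := Real.sqrt_pos.mpr hn'
    have hRu : u * σ * m ≤ R := by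
      refine le_of_sq_le_sq ?_ hR
      calc (u * σ * m) ^ 2 = 2 * (1 + lam) ^ 2 * σ ^ 2 * n := by
            rw [mul_pow, mul_pow, hu2, hm2]
        _ ≤ R ^ 2 := hR2
    set t : ℝ := u / (2 * σ * m) with ht
    have ht0 : 0 < t := by positivity
    obtain ⟨α, β, hαβ, hV⟩ := isPotential_cosh (E := E) hσ ht0.le
    refine (hV.measure_le hσ hζ hmean htail n (R := R) (v := Real.exp (u ^ 2 / 2) / 2)
      (by positivity) fun w hw => ?_).trans (ENNReal.ofReal_le_ofReal ?_)
    · have h1 : u ^ 2 / 2 ≤ t * ‖w‖ := by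
        calc u ^ 2 / 2 = t * (u * σ * m) := by rw [ht]; field_simp
          _ ≤ t * ‖w‖ := by gcongr; exact hRu.trans hw
      rw [Real.cosh_eq]
      have := Real.exp_le_exp.mpr h1
      have := Real.exp_pos (-(t * ‖w‖))
      linarith
    · have h1 : (α + β) ^ n = Real.exp (u ^ 2 / 4) := by
        rw [hαβ, ← Real.exp_nat_mul, ht, ← hm2]
        congr 1
        field_simp
        norm_num
      rw [h1, norm_zero, mul_zero, Real.cosh_zero, mul_one, div_le_iff₀ (by positivity),
        mul_div_assoc', ← Real.exp_add, le_div_iff₀ two_pos]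
      have h2 : (2 : ℝ) ≤ Real.exp (7 / 10) := by
        rw [← Real.log_le_iff_le_exp two_pos]
        linarith [Real.log_two_lt_d9]
      calc Real.exp (u ^ 2 / 4) * 2 ≤ Real.exp (u ^ 2 / 4) * Real.exp (7 / 10) := by gcongr
        _ = Real.exp (u ^ 2 / 4 + 7 / 10) := (Real.exp_add _ _).symm
        _ ≤ _ := Real.exp_le_exp.mpr (by rw [hu2]; nlinarith)

end

/-! ### The step size -/

section

variable {d : ℕ} {ℓ : ℝ → ℝ}

lemma one_le_ratio (hpos : ∀ s, 0 ≤ s → 0 < ℓ s) (hr : BddAbove (ratioSet ℓ)) :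
    1 ≤ ratio ℓ := by
  refine le_csSup hr ⟨0, Set.mem_Ici.mpr le_rfl, ?_⟩
  simp [(hpos 0 le_rfl).ne']

lemma ell_two_mul_le (hpos : ∀ s, 0 ≤ s → 0 < ℓ s) (hr : BddAbove (ratioSet ℓ)) {s : ℝ}
    (hs : 0 ≤ s) : ℓ (2 * s) ≤ ratio ℓ * ℓ s := by
  rw [← div_le_iff₀ (hpos s hs)]
  exact le_csSup hr ⟨s, hs, rfl⟩

lemma intervalIntegrable_one_div_ell (hmono : MonotoneOn ℓ (Set.Ici 0))
    (hpos : ∀ s, 0 ≤ s → 0 < ℓ s) {t : ℝ} (ht : 0 ≤ t) :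
    IntervalIntegrable (fun v => 1 / ℓ (t + t * v)) volume 0 1 := by
  refine AntitoneOn.intervalIntegrable fun v hv w hw hvw => ?_
  rw [Set.uIcc_of_le zero_le_one] at hv hw
  have hv0 : 0 ≤ t * v := mul_nonneg ht hv.1
  have hw0 : 0 ≤ t * w := mul_nonneg ht hw.1
  exact one_div_le_one_div_of_le (hpos _ (by linarith))
    (hmono (Set.mem_Ici.mpr (by linarith)) (Set.mem_Ici.mpr (by linarith)) (by gcongr))

lemma measurable_stepSize (hmono : MonotoneOn ℓ (Set.Ici 0)) (hpos : ∀ s, 0 ≤ s → 0 < ℓ s) :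
    Measurable (stepSize ℓ : Space d → ℝ) := by
  let φ : ℝ → ℝ := fun t => ∫ v in (0 : ℝ)..1, 1 / ℓ (max t 0 + max t 0 * v)
  have hφ : Antitone φ := by
    intro t u htu
    have ht : 0 ≤ max t 0 := le_max_right _ _
    have hu : 0 ≤ max u 0 := le_max_right _ _
    have hle : max t 0 ≤ max u 0 := max_le_max_right 0 htu
    refine intervalIntegral.integral_mono_on zero_le_one
      (intervalIntegrable_one_div_ell hmono hpos hu)
      (intervalIntegrable_one_div_ell hmono hpos ht) fun v hv => ?_
    have hv0 : 0 ≤ max t 0 * v := mul_nonneg ht hv.1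
    have hw0 : max t 0 * v ≤ max u 0 * v := mul_le_mul_of_nonneg_right hle hv.1
    exact one_div_le_one_div_of_le (hpos _ (by linarith))
      (hmono (Set.mem_Ici.mpr (by linarith)) (Set.mem_Ici.mpr (by linarith)) (by linarith))
  have heq : (stepSize ℓ : Space d → ℝ) = fun g => 1 / (5 * ratio ℓ) * φ ‖g‖ := by
    ext g
    simp only [stepSize, φ, max_eq_left (norm_nonneg g)]
  rw [heq]
  exact (hφ.measurable.comp measurable_norm).const_mul _

lemma stepSize_le (hmono : MonotoneOn ℓ (Set.Ici 0)) (hpos : ∀ s, 0 ≤ s → 0 < ℓ s)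
    (hr : BddAbove (ratioSet ℓ)) (g : Space d) {s : ℝ} (hs : 0 ≤ s) (hsg : s ≤ 2 * ‖g‖) :
    stepSize ℓ g ≤ 1 / (5 * ℓ s) := by
  have hr1 := one_le_ratio hpos hr
  have hg := norm_nonneg g
  have h1 : ∫ v in (0 : ℝ)..1, 1 / ℓ (‖g‖ + ‖g‖ * v) ≤ ∫ _ in (0 : ℝ)..1, 1 / ℓ ‖g‖ := by
    refine intervalIntegral.integral_mono_on zero_le_one
      (intervalIntegrable_one_div_ell hmono hpos hg) intervalIntegrable_const fun v hv => ?_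
    have hv0 : 0 ≤ ‖g‖ * v := mul_nonneg hg hv.1
    exact one_div_le_one_div_of_le (hpos _ hg)
      (hmono (Set.mem_Ici.mpr hg) (Set.mem_Ici.mpr (by linarith)) (by linarith))
  rw [intervalIntegral.integral_const, sub_zero, one_smul] at h1
  have h2 : ℓ s ≤ ratio ℓ * ℓ ‖g‖ :=
    (hmono (Set.mem_Ici.mpr hs) (Set.mem_Ici.mpr (by linarith)) hsg).trans
      (ell_two_mul_le hpos hr hg)
  have hls := hpos s hs
  have hlg := hpos _ hg
  calc stepSize ℓ g ≤ 1 / (5 * ratio ℓ) * (1 / ℓ ‖g‖) := by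
        rw [stepSize]; gcongr
    _ = 1 / (5 * (ratio ℓ * ℓ ‖g‖)) := by field_simp
    _ ≤ 1 / (5 * ℓ s) := by gcongr

lemma le_stepSize (hmono : MonotoneOn ℓ (Set.Ici 0)) (hpos : ∀ s, 0 ≤ s → 0 < ℓ s)
    (hr : BddAbove (ratioSet ℓ)) (g : Space d) {s : ℝ} (hsg : 2 * ‖g‖ ≤ s) :
    1 / (5 * ratio ℓ * ℓ s) ≤ stepSize ℓ g := by
  have hr1 := one_le_ratio hpos hr
  have hg := norm_nonneg g
  have h1 : ∫ _ in (0 : ℝ)..1, 1 / ℓ s ≤ ∫ v in (0 : ℝ)..1, 1 / ℓ (‖g‖ + ‖g‖ * v) := by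
    refine intervalIntegral.integral_mono_on zero_le_one intervalIntegrable_const
      (intervalIntegrable_one_div_ell hmono hpos hg) fun v hv => ?_
    have hv0 : 0 ≤ ‖g‖ * v := mul_nonneg hg hv.1
    have hv1 : ‖g‖ * v ≤ ‖g‖ := mul_le_of_le_one_right hg hv.2
    exact one_div_le_one_div_of_le (hpos _ (by linarith))
      (hmono (Set.mem_Ici.mpr (by linarith)) (Set.mem_Ici.mpr (by linarith)) (by linarith))
  rw [intervalIntegral.integral_const, sub_zero, one_smul] at h1
  calc 1 / (5 * ratio ℓ * ℓ s) = 1 / (5 * ratio ℓ) * (1 / ℓ s) := by rw [one_div_mul_one_div]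
    _ ≤ stepSize ℓ g := by rw [stepSize]; gcongr

end

/-! ### Descent along one step -/

section

variable {d : ℕ} {ℓ : ℝ → ℝ} {f : Space d → EReal}

lemma IsEllSmooth.coe_realPart (hf : IsEllSmooth ℓ f) {x : Space d} (hx : x ∈ domain f) :
    (realPart f x : EReal) = f x :=
  EReal.coe_toReal (ne_of_lt hx) (hf.ne_bot x)

/-- As long as the segment from `x` in direction `-h` stays in the domain and `h` is short, the
gradient stays close to its value at `x`: a fencing argument keeps its norm below `3 / 2 ‖∇f(x)‖`,
where the Hessian is bounded by `ℓ (3 / 2 ‖∇f(x)‖)`. -/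
lemma IsEllSmooth.norm_grad_sub_le (hf : IsEllSmooth ℓ f) {x h : Space d} {t : ℝ} (ht1 : t ≤ 1)
    (hdom : ∀ s ∈ Set.Icc 0 t, x - s • h ∈ domain f) (hn : 0 < ‖grad f x‖)
    (hh : ℓ (3 / 2 * ‖grad f x‖) * ‖h‖ ≤ ‖grad f x‖ / 4) :
    ∀ s ∈ Set.Icc 0 t, ‖grad f (x - s • h) - grad f x‖ ≤ s * (‖grad f x‖ / 3) := by
  set n := ‖grad f x‖ with hn_def
  have hline : ∀ s : ℝ, HasDerivAt (fun s : ℝ => x - s • h) (-h) s := fun s => by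
    simpa using ((hasDerivAt_id s).smul_const h).const_sub x
  have hder : ∀ s ∈ Set.Icc 0 t, HasDerivAt (fun s : ℝ => grad f (x - s • h) - grad f x)
      (hess f (x - s • h) (-h)) s := fun s hs =>
    ((hf.twice_differentiable _ (hdom s hs)).hasFDerivAt.comp_hasDerivAt s (hline s)).sub_const _
  have hB : ∀ s : ℝ, HasDerivAt (fun s : ℝ => s * (n / 3)) (n / 3) s := fun s => by
    simpa using (hasDerivAt_id s).mul_const (n / 3)
  refine image_norm_le_of_norm_deriv_right_lt_deriv_boundary
    (fun s hs => (hder s hs).continuousAt.continuousWithinAt)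
    (fun s hs => (hder s (Set.Ico_subset_Icc_self hs)).hasDerivWithinAt) (by simp) hB
    fun s hs heq => ?_
  have hle : ‖grad f (x - s • h)‖ ≤ 3 / 2 * n := by
    have h1 := norm_le_norm_add_norm_sub' (grad f (x - s • h)) (grad f x)
    have h2 : s * (n / 3) ≤ n / 3 := mul_le_of_le_one_left (by positivity) (hs.2.le.trans ht1)
    linarith
  calc ‖hess f (x - s • h) (-h)‖ ≤ ‖hess f (x - s • h)‖ * ‖h‖ := by
        simpa using (hess f (x - s • h)).le_opNorm (-h)
    _ ≤ ℓ (3 / 2 * n) * ‖h‖ := by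
        gcongr
        refine (hf.hess_le _ (hdom s (Set.Ico_subset_Icc_self hs))).trans ?_
        exact hf.ell_monotone (Set.mem_Ici.mpr (norm_nonneg _))
          (Set.mem_Ici.mpr (by positivity)) hle
    _ ≤ n / 4 := hh
    _ < n / 3 := by linarith

/-- While the segment from `x` to `x - γ g` stays in the domain, `f` decreases along it, if `g` is
a good approximation of `∇f(x)` and the step is short. -/
lemma IsEllSmooth.realPart_sub_smul_le (hf : IsEllSmooth ℓ f) {x g : Space d} {γ t : ℝ}
    (hγ : 0 ≤ γ) (ht0 : 0 ≤ t) (ht1 : t ≤ 1)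
    (hdom : ∀ s ∈ Set.Icc 0 t, x - s • γ • g ∈ domain f) (hn : 0 < ‖grad f x‖)
    (hg : ‖g - grad f x‖ ≤ ‖grad f x‖ / 4)
    (hh : ℓ (3 / 2 * ‖grad f x‖) * ‖γ • g‖ ≤ ‖grad f x‖ / 4) :
    realPart f (x - t • γ • g) ≤ realPart f x - t * (γ * ‖grad f x‖ ^ 2 / 4) := by
  have hgrad := hf.norm_grad_sub_le ht1 hdom hn hh
  set n := ‖grad f x‖ with hn_def
  have hline : ∀ s : ℝ, HasDerivAt (fun s : ℝ => x - s • γ • g) (-(γ • g)) s := fun s => by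
    simpa using ((hasDerivAt_id s).smul_const (γ • g)).const_sub x
  have hder : ∀ s ∈ Set.Icc 0 t, HasDerivAt (fun s : ℝ => realPart f (x - s • γ • g))
      (inner ℝ (grad f (x - s • γ • g)) (-(γ • g))) s := fun s hs => by
    have h := (hf.differentiable _ (hdom s hs)).hasGradientAt.hasFDerivAt.comp_hasDerivAt s
      (hline s)
    rwa [InnerProductSpace.toDual_apply_apply] at h
  have hB : ∀ s : ℝ, HasDerivAt (fun s : ℝ => realPart f x - s * (γ * n ^ 2 / 4))
      (-(γ * n ^ 2 / 4)) s := fun s => by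
    simpa using ((hasDerivAt_id s).mul_const (γ * n ^ 2 / 4)).const_sub (realPart f x)
  refine image_le_of_deriv_right_le_deriv_boundary
    (f := fun s : ℝ => realPart f (x - s • γ • g))
    (f' := fun s => inner ℝ (grad f (x - s • γ • g)) (-(γ • g)))
    (B := fun s : ℝ => realPart f x - s * (γ * n ^ 2 / 4)) (B' := fun _ => -(γ * n ^ 2 / 4))
    (fun s hs => (hder s hs).continuousAt.continuousWithinAt)
    (fun s hs => (hder s (Set.Ico_subset_Icc_self hs)).hasDerivWithinAt) (by simp)
    (fun s hs => (hB s).continuousAt.continuousWithinAt)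
    (fun s hs => (hB s).hasDerivWithinAt) (fun s hs => ?_) (Set.right_mem_Icc.mpr ht0)
  have hs' := Set.Ico_subset_Icc_self hs
  have h1 : ‖grad f (x - s • γ • g) - grad f x‖ ≤ n / 3 :=
    (hgrad s hs').trans (mul_le_of_le_one_left (by positivity) (hs'.2.trans ht1))
  have h2 := (abs_le.mp (abs_real_inner_le_norm (grad f (x - s • γ • g) - grad f x) g)).1
  rw [inner_sub_left] at h2
  have h3 : ‖g - grad f x‖ ^ 2 ≤ (n / 4) ^ 2 := by gcongr
  rw [norm_sub_sq_real, real_inner_comm, ← hn_def] at h3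
  have h4 : ‖grad f (x - s • γ • g) - grad f x‖ * ‖g‖ ≤ n / 3 * ‖g‖ := by gcongr
  rw [inner_neg_right, inner_smul_right]
  have h5 : n ^ 2 / 4 ≤ inner ℝ (grad f (x - s • γ • g)) g := by
    nlinarith [sq_nonneg (n - ‖g‖)]
  have := mul_le_mul_of_nonneg_left h5 hγ
  linarith

/-- The step does not leave the domain: at the first point of the segment outside the domain, `f`
would be infinite, but it is bounded by `f x` before that point and continuous up to it. -/
lemma IsEllSmooth.sub_smul_mem_domain (hf : IsEllSmooth ℓ f) {x g : Space d} {γ : ℝ}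
    (hx : x ∈ domain f) (hγ : 0 ≤ γ) (hn : 0 < ‖grad f x‖)
    (hg : ‖g - grad f x‖ ≤ ‖grad f x‖ / 4)
    (hh : ℓ (3 / 2 * ‖grad f x‖) * ‖γ • g‖ ≤ ‖grad f x‖ / 4) :
    ∀ t ∈ Set.Icc (0 : ℝ) 1, x - t • γ • g ∈ domain f := by
  by_contra! hcon
  set y : ℝ → Space d := fun s => x - s • γ • g with hy
  have hyc : Continuous y := by fun_prop
  set S : Set ℝ := Set.Icc 0 1 ∩ y ⁻¹' (domain f)ᶜ with hS
  have hScomp : IsCompact S :=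
    isCompact_Icc.inter_right (hf.isOpen_domain.isClosed_compl.preimage hyc)
  obtain ⟨τ, hτS, hτ⟩ := hScomp.exists_isLeast (by
    obtain ⟨t, ht, ht'⟩ := hcon
    exact ⟨t, ht, ht'⟩)
  have hbefore : ∀ s, 0 ≤ s → s < τ → y s ∈ domain f := by
    intro s hs hsτ
    by_contra hs'
    exact absurd (hτ ⟨⟨hs, hsτ.le.trans hτS.1.2⟩, hs'⟩) (not_le.mpr hsτ)
  have hτ0 : 0 < τ := by
    refine lt_of_le_of_ne hτS.1.1 fun h0 => hτS.2 ?_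
    simpa [hy, ← h0] using hx
  have hbound : ∀ s ∈ Set.Ico 0 τ, f (y s) ≤ f x := by
    intro s hs
    have h1 := hf.realPart_sub_smul_le hγ hs.1 (hs.2.le.trans hτS.1.2)
      (fun u hu => hbefore u hu.1 (hu.2.trans_lt hs.2)) hn hg hh
    have h2 : 0 ≤ s * (γ * ‖grad f x‖ ^ 2 / 4) := mul_nonneg hs.1 (by positivity)
    rw [← hf.coe_realPart (hbefore s hs.1 hs.2), ← hf.coe_realPart hx]
    exact EReal.coe_le_coe_iff.mpr (h1.trans (sub_le_self _ h2))
  have hmaps : Set.MapsTo y (Set.Ico 0 τ) (closure (domain f)) := fun s hs =>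
    subset_closure (hbefore s hs.1 hs.2)
  have hτmem : τ ∈ closure (Set.Ico 0 τ) := by
    rw [closure_Ico hτ0.ne]
    exact Set.right_mem_Icc.mpr hτ0.le
  have hyτ : y τ ∈ closure (domain f) := by
    have := hmaps.closure hyc hτmem
    rwa [closure_closure] at this
  have hcont : ContinuousWithinAt (f ∘ y) (Set.Ico 0 τ) τ :=
    (hf.continuousOn_closure (y τ) hyτ).comp hyc.continuousWithinAt hmaps
  have hle : f (y τ) ≤ f x :=
    hcont.closure_le hτmem continuousWithinAt_const hbound
  exact hτS.2 (hle.trans_lt hx)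

/-- One step of the method, in terms of the gradient at the current point: the step size satisfies
`1 / (5 r ℓ(3 ‖∇f(x)‖)) ≤ γ ≤ 1 / (5 ℓ(3 / 2 ‖∇f(x)‖))`. -/
theorem IsEllSmooth.step (hf : IsEllSmooth ℓ f) (hr : BddAbove (ratioSet ℓ)) {x g : Space d}
    (hx : x ∈ domain f) (hn : 0 < ‖grad f x‖) (hg : ‖g - grad f x‖ ≤ ‖grad f x‖ / 4) :
    x - stepSize ℓ g • g ∈ domain f ∧
      (3 / 2 * ‖grad f x‖) ^ 2 / ℓ (3 * ‖grad f x‖) ≤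
        45 * ratio ℓ * (realPart f x - realPart f (x - stepSize ℓ g • g)) := by
  have hr1 := one_le_ratio hf.ell_pos hr
  set n := ‖grad f x‖ with hn_def
  have hg1 : ‖g‖ ≤ 5 / 4 * n := by
    have := norm_le_norm_add_norm_sub' g (grad f x)
    linarith
  have hg2 : 3 / 4 * n ≤ ‖g‖ := by
    have := norm_le_norm_add_norm_sub g (grad f x)
    linarith
  have hl : 0 < ℓ (3 / 2 * n) := hf.ell_pos _ (by positivity)
  have hl3 : 0 < ℓ (3 * n) := hf.ell_pos _ (by positivity)
  have hub := stepSize_le hf.ell_monotone hf.ell_pos hr g (s := 3 / 2 * n) (by positivity)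
    (by linarith)
  have hlb := le_stepSize hf.ell_monotone hf.ell_pos hr g (s := 3 * n) (by linarith)
  have hγ : 0 ≤ stepSize ℓ g := le_trans (by positivity) hlb
  set γ := stepSize ℓ g
  have hh : ℓ (3 / 2 * n) * ‖γ • g‖ ≤ n / 4 := by
    rw [norm_smul, Real.norm_of_nonneg hγ]
    calc ℓ (3 / 2 * n) * (γ * ‖g‖) ≤ ℓ (3 / 2 * n) * (1 / (5 * ℓ (3 / 2 * n)) * (5 / 4 * n)) := by
          gcongr
      _ = n / 4 := by
          generalize ℓ (3 / 2 * n) = L at hl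
          field_simp
  have hmem := hf.sub_smul_mem_domain hx hγ hn hg hh
  have hdesc := hf.realPart_sub_smul_le hγ zero_le_one le_rfl hmem hn hg hh
  have hmem1 := hmem 1 (Set.right_mem_Icc.mpr zero_le_one)
  rw [one_smul] at hmem1 hdesc
  refine ⟨hmem1, ?_⟩
  rw [one_mul, ← hn_def] at hdesc
  calc (3 / 2 * n) ^ 2 / ℓ (3 * n)
      = 45 * ratio ℓ * (1 / (5 * ratio ℓ * ℓ (3 * n)) * n ^ 2 / 4) := by field_simp; norm_num
    _ ≤ 45 * ratio ℓ * (γ * n ^ 2 / 4) := by gcongr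
    _ ≤ _ := by gcongr; linarith

/-- Summing the descent over `T` steps. The accuracy of a gradient estimator is only required as
long as the iterates have stayed in the domain. -/
theorem IsEllSmooth.mem_domain_and_minIter_le (hf : IsEllSmooth ℓ f) (hr : BddAbove (ratioSet ℓ))
    {fstar : ℝ} (hfstar : ∀ x ∈ domain f, (fstar : EReal) ≤ f x) {T : ℕ} (hT : 1 ≤ T)
    {x g : ℕ → Space d} (hx₀ : x 0 ∈ domain f)
    (hstep : ∀ k, x (k + 1) = x k - stepSize ℓ (g k) • g k)
    (hacc : ∀ k < T, (∀ i ≤ k, x i ∈ domain f) →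
      0 < ‖grad f (x k)‖ ∧ ‖g k - grad f (x k)‖ ≤ ‖grad f (x k)‖ / 4) :
    (∀ k ≤ T, x k ∈ domain f) ∧
      minIter T hT (fun k => (3 / 2 * ‖grad f (x k)‖) ^ 2 / ℓ (3 * ‖grad f (x k)‖))
        ≤ ratio ℓ * (45 * (realPart f (x 0) - fstar) / T) := by
  set a : ℕ → ℝ := fun k => (3 / 2 * ‖grad f (x k)‖) ^ 2 / ℓ (3 * ‖grad f (x k)‖)
  have hr1 := one_le_ratio hf.ell_pos hr
  have hT0 : (0 : ℝ) < T := by exact_mod_cast hT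
  have hmain : ∀ k ≤ T, (∀ i ≤ k, x i ∈ domain f) ∧
      k * minIter T hT a ≤ 45 * ratio ℓ * (realPart f (x 0) - realPart f (x k)) := by
    intro k
    induction k with
    | zero =>
      intro _
      refine ⟨fun i hi => ?_, by simp⟩
      rwa [Nat.le_zero.mp hi]
    | succ k ih =>
      intro hk
      obtain ⟨hdom, hsum⟩ := ih (Nat.le_of_succ_le hk)
      obtain ⟨hn, hg⟩ := hacc k hk hdom
      obtain ⟨hmem, hdesc⟩ := hf.step hr (hdom k le_rfl) hn hg
      rw [← hstep k] at hmem hdesc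
      refine ⟨fun i hi => ?_, ?_⟩
      · rcases Nat.le_succ_iff.mp hi with h | h
        · exact hdom i h
        · rwa [h]
      · have hmin : minIter T hT a ≤ a k := Finset.inf'_le a (Finset.mem_range.mpr hk)
        push_cast
        linarith
  obtain ⟨hdom, hsum⟩ := hmain T le_rfl
  refine ⟨hdom, ?_⟩
  have hlow : fstar ≤ realPart f (x T) := by
    rw [← EReal.coe_le_coe_iff, hf.coe_realPart (hdom T le_rfl)]
    exact hfstar _ (hdom T le_rfl)
  rw [← mul_div_assoc, le_div_iff₀ hT0]
  calc minIter T hT a * T ≤ 45 * ratio ℓ * (realPart f (x 0) - realPart f (x T)) := by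
        linarith
    _ ≤ 45 * ratio ℓ * (realPart f (x 0) - fstar) := by gcongr
    _ = _ := by ring

end

/-! ### Minibatch estimators -/

section

variable {d : ℕ} {Ξ : Type*}

lemma queryBatch_eq (G : Space d → Ξ → Space d) (x : Space d) (s : ℕ → Ξ) (n : ℕ) :
    queryBatch G x s n = (∑ j : Fin n, G x (s j), n) := by
  rw [Fin.sum_univ_eq_sum_range (fun j => G x (s j))]
  induction n with
  | zero => rfl
  | succ n ih => simp [queryBatch, ih, Finset.sum_range_succ]

lemma batchGrad_eq (G : Space d → Ξ → Space d) (B : ℕ) (x : Space d) (s : ℕ → Ξ) :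
    batchGrad G B x s = (1 / (B : ℝ)) • ∑ j : Fin B, G x (s j) := by
  rw [batchGrad, queryBatch_eq]

lemma sgd_calls (ℓ : ℝ → ℝ) (G : Space d → Ξ → Space d) (B : ℕ) (x₀ : Space d)
    (s : ℕ → ℕ → Ξ) (k : ℕ) : (sgd ℓ G B x₀ s k).calls = B * k := by
  induction k with
  | zero => rfl
  | succ k ih => simp only [sgd, ih, queryBatch_eq, Nat.mul_succ]

variable [MeasurableSpace Ξ] {f : Space d → EReal} {G : Space d → Ξ → Space d} {P : Measure Ξ}
  {σ : ℝ}

lemma measurable_grad (f : Space d → EReal) : Measurable (grad f) :=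
  (InnerProductSpace.toDual ℝ (Space d)).symm.continuous.measurable.comp
    (measurable_fderiv ℝ (realPart f))

lemma measurable_batch (hG : Measurable (Function.uncurry G)) (B : ℕ) :
    Measurable fun y : Space d × (Fin B → Ξ) => (1 / (B : ℝ)) • ∑ j, G y.1 (y.2 j) := by
  have h : Measurable fun y : Space d × (Fin B → Ξ) => ∑ j, G y.1 (y.2 j) :=
    Finset.measurable_fun_sum _ fun j _ => hG.comp
      (measurable_fst.prodMk ((measurable_pi_apply j).comp measurable_snd))
  exact h.const_smul (1 / (B : ℝ))

/-- At a fixed point, a batch of the prescribed size estimates the gradient up to `√ε / 4`, except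
with probability `δ / T`. -/
theorem IsLightTailedOracle.measure_batch_sub_grad_gt_le [IsProbabilityMeasure P]
    (hG : IsLightTailedOracle f G P σ) (hσ : 0 < σ) {ε δ : ℝ} (hε : 0 < ε) (hδ : 0 < δ)
    (hδ1 : δ < 1) {T : ℕ} (hT : 1 ≤ T) {B : ℕ} (hB : B = batchSize T δ σ ε) {x : Space d}
    (hx : x ∈ domain f) :
    Measure.pi (fun _ : Fin B => P)
        {s | Real.sqrt ε / 4 < ‖(1 / (B : ℝ)) • ∑ j, G x (s j) - grad f x‖}
      ≤ ENNReal.ofReal (δ / T) := by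
  have hT1 : (1 : ℝ) ≤ T := by exact_mod_cast hT
  have hB0 : 0 < B := by
    rw [hB]
    exact lt_of_lt_of_le one_pos (le_max_right _ _)
  have hB0' : (0 : ℝ) < B := Nat.cast_pos.mpr hB0
  have hGx : Measurable (G x) := hG.measurable.comp measurable_prodMk_left
  have hζ : Measurable fun z => G x z - grad f x := hGx.sub_const _
  have htail := hG.light_tail x hx
  have hGint : Integrable (G x) P := by
    have h := (integrable_of_exp_sq hσ hζ (integrable_exp_sq hζ htail)).add
      (integrable_const (grad f x))
    refine h.congr (Filter.Eventually.of_forall fun z => ?_)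
    simp
  have hmean : ∫ z, (G x z - grad f x) ∂P = 0 := by
    rw [integral_sub hGint (integrable_const _), hG.unbiased x hx]
    simp
  have hlog : 0 ≤ 3 * Real.log (T / δ) := by
    have : 0 ≤ Real.log (T / δ) := Real.log_nonneg ((one_le_div hδ).mpr (hδ1.le.trans hT1))
    positivity
  set lam := Real.sqrt (3 * Real.log (T / δ)) with hlam
  have hsize : 32 * (1 + lam) ^ 2 * σ ^ 2 ≤ B * ε := by
    rw [← div_le_iff₀ hε, hB]
    exact (Nat.le_ceil _).trans (Nat.cast_le.mpr (le_max_left _ _))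
  have hconc := measure_norm_sum_ge_le hσ hζ hmean htail hB0 (lam := lam)
    (R := B * (Real.sqrt ε / 4)) (Real.sqrt_nonneg _) (by positivity) (by
      rw [mul_pow, div_pow, Real.sq_sqrt hε.le]
      nlinarith [mul_le_mul_of_nonneg_left hsize hB0'.le])
  refine (measure_mono fun s hs => ?_).trans (hconc.trans_eq ?_)
  · have hsum : ∑ j : Fin B, (G x (s j) - grad f x) =
        (B : ℝ) • ((1 / (B : ℝ)) • ∑ j, G x (s j) - grad f x) := by
      rw [Finset.sum_sub_distrib, smul_sub, smul_smul, mul_one_div_cancel hB0'.ne', one_smul]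
      simp [Nat.cast_smul_eq_nsmul]
    change (B : ℝ) * (Real.sqrt ε / 4) ≤ ‖∑ j : Fin B, (G x (s j) - grad f x)‖
    rw [hsum, norm_smul, Real.norm_of_nonneg hB0'.le]
    exact mul_le_mul_of_nonneg_left (le_of_lt hs) hB0'.le
  · rw [hlam, Real.sq_sqrt hlog, mul_div_cancel_left₀ _ three_ne_zero, Real.exp_neg,
      Real.exp_log (by positivity), inv_div]

end

/-! ### The random iterates -/

section

variable {d : ℕ} {Ξ Ω : Type*} [MeasurableSpace Ξ]
  {ℓ : ℝ → ℝ} {G : Space d → Ξ → Space d} {B : ℕ} {ξ : ℕ → ℕ → Ω → Ξ}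

/-- The `k`-th iterate is a function of the samples used before iteration `k`. -/
lemma measurable_sgd_point (hmono : MonotoneOn ℓ (Set.Ici 0)) (hpos : ∀ s, 0 ≤ s → 0 < ℓ s)
    (hG : Measurable (Function.uncurry G)) (x₀ : Space d) (k : ℕ) :
    Measurable[⨆ p ∈ {p : ℕ × Fin B | p.1 < k}, MeasurableSpace.comap (ξ p.1 p.2) inferInstance]
      fun ω => (sgd ℓ G B x₀ (fun i j => ξ i j ω) k).point := by
  induction k with
  | zero => exact measurable_const
  | succ k ih =>
    set m := ⨆ p ∈ {p : ℕ × Fin B | p.1 < k + 1},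
      MeasurableSpace.comap (ξ p.1 p.2) inferInstance with hm
    have hx : Measurable[m] fun ω => (sgd ℓ G B x₀ (fun i j => ξ i j ω) k).point :=
      ih.mono (biSup_mono fun p hp => Nat.lt_succ_of_lt hp) le_rfl
    have hξ : ∀ j : Fin B, Measurable[m] (ξ k j) := fun j =>
      (comap_measurable (ξ k j)).mono
        (le_biSup (fun p : ℕ × Fin B => MeasurableSpace.comap (ξ p.1 p.2) inferInstance)
          (i := (k, j)) (Nat.lt_succ_self k)) le_rfl
    have hg : Measurable[m] fun ω =>
        batchGrad G B (sgd ℓ G B x₀ (fun i j => ξ i j ω) k).point (fun j => ξ k j ω) := by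
      simp only [batchGrad_eq]
      exact (measurable_batch hG B).comp
        (hx.prodMk (measurable_pi_lambda _ hξ))
    exact hx.sub (((measurable_stepSize hmono hpos).comp hg).smul hg)

/-- Since the iterate and the fresh batch are independent, an event about the two that has
probability at most `c` for every value of the iterate has probability at most `c`. -/
lemma measure_sgd_point_batch_le [mΩ : MeasurableSpace Ω] {μ : Measure Ω}
    [IsProbabilityMeasure μ] {P : Measure Ξ} [IsProbabilityMeasure P]
    (hmono : MonotoneOn ℓ (Set.Ici 0)) (hpos : ∀ s, 0 ≤ s → 0 < ℓ s)
    (hG : Measurable (Function.uncurry G)) (x₀ : Space d)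
    (hξ_meas : ∀ k, ∀ j < B, Measurable (ξ k j))
    (hξ_law : ∀ k, ∀ j < B, μ.map (ξ k j) = P)
    (hξ_indep : iIndepFun (fun p : ℕ × Fin B => ξ p.1 p.2) μ) (k : ℕ)
    {A : Set (Space d × (Fin B → Ξ))} (hA : MeasurableSet A) {c : ENNReal}
    (hc : ∀ x, Measure.pi (fun _ : Fin B => P) (Prod.mk x ⁻¹' A) ≤ c) :
    μ {ω | ((sgd ℓ G B x₀ (fun i j => ξ i j ω) k).point, fun j : Fin B => ξ k j ω) ∈ A} ≤ c := by
  set X : Ω → Space d := fun ω => (sgd ℓ G B x₀ (fun i j => ξ i j ω) k).point with hX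
  set Y : Ω → Fin B → Ξ := fun ω j => ξ k j ω with hY
  have hm : ∀ p : ℕ × Fin B, MeasurableSpace.comap (ξ p.1 p.2) inferInstance ≤ mΩ := fun p =>
    (hξ_meas p.1 p.2 p.2.isLt).comap_le
  have hXm := measurable_sgd_point (ξ := ξ) (B := B) hmono hpos hG x₀ k
  have hYm : Measurable[⨆ p ∈ {p : ℕ × Fin B | p.1 = k},
      MeasurableSpace.comap (ξ p.1 p.2) inferInstance] Y :=
    @measurable_pi_lambda _ _ _ (_) _ _ fun j => (comap_measurable (ξ k j)).mono
      (le_biSup (fun p : ℕ × Fin B => MeasurableSpace.comap (ξ p.1 p.2) inferInstance)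
        (i := (k, j)) rfl) le_rfl
  have hindep : IndepFun X Y μ := by
    refine indep_of_indep_of_le_left (indep_of_indep_of_le_right
      (indep_iSup_of_disjoint hm hξ_indep.iIndep ?_) hYm.comap_le) hXm.comap_le
    exact Set.disjoint_left.mpr fun p (hp : p.1 < k) (hp' : p.1 = k) => hp.ne hp'
  have hX' : Measurable X := hXm.mono (iSup₂_le fun p _ => hm p) le_rfl
  have hY' : Measurable Y := hYm.mono (iSup₂_le fun p _ => hm p) le_rfl
  have hYlaw : μ.map Y = Measure.pi fun _ : Fin B => P := by
    have hinj : Function.Injective fun j : Fin B => (k, j) := fun i j h => (Prod.mk.inj h).2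
    have h := (iIndepFun_iff_map_fun_eq_pi_map
      (fun j : Fin B => (hξ_meas k j j.isLt).aemeasurable)).mp (hξ_indep.precomp hinj)
    rw [hY, h]
    congr 1
    ext1 j
    exact hξ_law k j j.isLt
  have hXprob : IsProbabilityMeasure (μ.map X) := Measure.isProbabilityMeasure_map hX'.aemeasurable
  have hlaw := (indepFun_iff_map_prod_eq_prod_map_map hX'.aemeasurable hY'.aemeasurable).mp hindep
  calc μ {ω | (X ω, Y ω) ∈ A} = μ.map (fun ω => (X ω, Y ω)) A :=
        (Measure.map_apply (hX'.prodMk hY') hA).symm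
    _ = ∫⁻ x, Measure.pi (fun _ : Fin B => P) (Prod.mk x ⁻¹' A) ∂(μ.map X) := by
        rw [hlaw, hYlaw, Measure.prod_apply hA]
    _ ≤ ∫⁻ _, c ∂(μ.map X) := lintegral_mono hc
    _ = c := by simp

end

end EllSmooth

/-- `X` is the effective domain of `f`, `Δ = f x₀ - f*`, and `x_k` is the `k`-th point of the
method run on the random samples `ξ k j`. The hypothesis `hTε` says that `T` is large enough for the
bound `min_{k<T} (3/2 ‖∇f(x_k)‖)² / ℓ (3 ‖∇f(x_k)‖) ≤ r * (45 Δ / T)` on iterates in `X` to ensure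
`min_{k<T} ‖∇f(x_k)‖² ≤ ε`. -/
theorem mainTheorem11 {d : ℕ} {Ξ Ω : Type*} [MeasurableSpace Ξ] [MeasurableSpace Ω]
    (f : EllSmooth.Space d → EReal) (ℓ : ℝ → ℝ)
    (hf : EllSmooth.IsEllSmooth ℓ f)
    (hr : BddAbove (EllSmooth.ratioSet ℓ))
    (fstar : ℝ) (hfstar : ∀ x ∈ EllSmooth.domain f, (fstar : EReal) ≤ f x)
    (x₀ : EllSmooth.Space d) (hx₀ : x₀ ∈ EllSmooth.domain f)
    (P : Measure Ξ) [IsProbabilityMeasure P]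
    (G : EllSmooth.Space d → Ξ → EllSmooth.Space d) (σ : ℝ) (hσ : 0 < σ)
    (hG : EllSmooth.IsLightTailedOracle f G P σ)
    (ε : ℝ) (hε : 0 < ε) (δ : ℝ) (hδ : 0 < δ) (hδ1 : δ < 1)
    (T : ℕ) (hT : 1 ≤ T) (B : ℕ) (hB : B = EllSmooth.batchSize T δ σ ε)
    (μ : Measure Ω) [IsProbabilityMeasure μ]
    (ξ : ℕ → ℕ → Ω → Ξ)
    (hξ_meas : ∀ k, ∀ j < B, Measurable (ξ k j))
    (hξ_law : ∀ k, ∀ j < B, μ.map (ξ k j) = P)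
    (hξ_indep : iIndepFun (fun p : ℕ × Fin B => ξ p.1 p.2) μ)
    (x : ℕ → Ω → EllSmooth.Space d)
    (hx : ∀ k ω, x k ω = (EllSmooth.sgd ℓ G B x₀ (fun i j => ξ i j ω) k).point)
    (hTε : ∀ᵐ ω ∂μ, (∀ k < T, x k ω ∈ EllSmooth.domain f) →
      EllSmooth.minIter T hT (fun k =>
          (3 / 2 * ‖EllSmooth.grad f (x k ω)‖) ^ 2 / ℓ (3 * ‖EllSmooth.grad f (x k ω)‖))
        ≤ EllSmooth.ratio ℓ * (45 * (EllSmooth.realPart f x₀ - fstar) / T) →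
      EllSmooth.minIter T hT (fun k => ‖EllSmooth.grad f (x k ω)‖ ^ 2) ≤ ε) :
    ENNReal.ofReal (1 - δ) ≤
        μ {ω | ∃ k < T, (∀ i ≤ k, x i ω ∈ EllSmooth.domain f) ∧
          ‖EllSmooth.grad f (x k ω)‖ ^ 2 ≤ ε} ∧
      ∀ ω, (EllSmooth.sgd ℓ G B x₀ (fun i j => ξ i j ω) T).calls = B * T := by
  refine ⟨?_, fun ω => EllSmooth.sgd_calls ℓ G B x₀ _ T⟩
  set g : ℕ → Ω → EllSmooth.Space d := fun k ω =>
    EllSmooth.batchGrad G B (x k ω) (fun j => ξ k j ω) with hg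
  set good : Set Ω := {ω | ∃ k < T, (∀ i ≤ k, x i ω ∈ EllSmooth.domain f) ∧
    ‖EllSmooth.grad f (x k ω)‖ ^ 2 ≤ ε} with hgood
  let bad : ℕ → Set Ω := fun k => {ω | x k ω ∈ EllSmooth.domain f ∧
    Real.sqrt ε / 4 < ‖g k ω - EllSmooth.grad f (x k ω)‖}
  have hbad : ∀ k, μ (bad k) ≤ ENNReal.ofReal (δ / T) := by
    intro k
    let A : Set (EllSmooth.Space d × (Fin B → Ξ)) := {y | y.1 ∈ EllSmooth.domain f ∧
      Real.sqrt ε / 4 < ‖(1 / (B : ℝ)) • ∑ j, G y.1 (y.2 j) - EllSmooth.grad f y.1‖}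
    have hA : MeasurableSet A :=
      (hf.isOpen_domain.measurableSet.preimage measurable_fst).inter
        (measurableSet_lt measurable_const ((EllSmooth.measurable_batch hG.measurable B).sub
          ((EllSmooth.measurable_grad f).comp measurable_fst)).norm)
    refine le_trans (le_of_eq ?_) (EllSmooth.measure_sgd_point_batch_le hf.ell_monotone hf.ell_pos
      hG.measurable x₀ hξ_meas hξ_law hξ_indep k hA fun y => ?_)
    · congr 1
      ext ω
      simp only [bad, A, hg, Set.mem_ofPred_eq, EllSmooth.batchGrad_eq, hx]
    · by_cases hy : y ∈ EllSmooth.domain f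
      · refine (measure_mono fun s hs => ?_).trans
          (hG.measure_batch_sub_grad_gt_le hσ hε hδ hδ1 hT hB hy)
        exact hs.2
      · have : Prod.mk y ⁻¹' A = ∅ := Set.eq_empty_of_forall_notMem fun s hs => hy hs.1
        simp [this]
  have hsub : ∀ᵐ ω ∂μ, ω ∈ goodᶜ → ω ∈ ⋃ k ∈ Finset.range T, bad k := by
    filter_upwards [hTε] with ω hω hnot
    by_contra hnb
    simp only [Set.mem_iUnion, Finset.mem_range, not_exists] at hnb
    have hlarge : ∀ k < T, (∀ i ≤ k, x i ω ∈ EllSmooth.domain f) →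
        Real.sqrt ε < ‖EllSmooth.grad f (x k ω)‖ := by
      intro k hk hdom
      by_contra! hle
      refine hnot ⟨k, hk, hdom, ?_⟩
      rw [← Real.sq_sqrt hε.le]
      gcongr
    obtain ⟨hdom, hmin⟩ := hf.mem_domain_and_minIter_le hr hfstar hT (x := fun k => x k ω)
      (g := fun k => g k ω) (by simpa [hx, EllSmooth.sgd] using hx₀)
      (fun k => by simp only [hg, hx, EllSmooth.sgd]) fun k hk hdom => by
        have hn := hlarge k hk hdom
        refine ⟨(Real.sqrt_nonneg ε).trans_lt hn, ?_⟩
        have hacc : ‖g k ω - EllSmooth.grad f (x k ω)‖ ≤ Real.sqrt ε / 4 := by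
          by_contra! hlt
          exact hnb k hk ⟨hdom k le_rfl, hlt⟩
        linarith
    have hx0 : x 0 ω = x₀ := by simp [hx, EllSmooth.sgd]
    simp only [hx0] at hmin
    have hfin := hω (fun k hk => hdom k hk.le) hmin
    obtain ⟨k, hk, hke⟩ := (Finset.inf'_le_iff _).mp hfin
    have hkT := Finset.mem_range.mp hk
    exact hnot ⟨k, hkT, fun i hi => hdom i (hi.trans hkT.le), hke⟩
  have hcompl : μ goodᶜ ≤ ENNReal.ofReal δ := by
    have hT0 : (0 : ℝ) < T := by exact_mod_cast hT
    calc μ goodᶜ ≤ μ (⋃ k ∈ Finset.range T, bad k) := measure_mono_ae hsub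
      _ ≤ ∑ k ∈ Finset.range T, μ (bad k) := measure_biUnion_finset_le _ _
      _ ≤ ∑ _k ∈ Finset.range T, ENNReal.ofReal (δ / T) := Finset.sum_le_sum fun k _ => hbad k
      _ = ENNReal.ofReal δ := by
          rw [Finset.sum_const, Finset.card_range, ← ENNReal.ofReal_nsmul, nsmul_eq_mul,
            mul_div_cancel₀ _ hT0.ne']
  rw [ENNReal.ofReal_sub _ hδ.le, ENNReal.ofReal_one, tsub_le_iff_right]
  calc 1 = μ (good ∪ goodᶜ) := by rw [Set.union_compl_self, measure_univ]
    _ ≤ μ good + μ goodᶜ := measure_union_le _ _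
    _ ≤ μ good + ENNReal.ofReal δ := by gcongr
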